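/- Let $\mathcal A$ be an abelian category with small hom-sets which is \emph{quasi-locally presentable}: there are full subcategories $\mathcal A_\lambda\subseteq\mathcal A$, one for each regular (infinite) cardinal $\lambda$, with $\mathcal A=\bigcup_\lambda\mathcal A_\lambda$, such that each $\mathcal A_\lambda$ is locally $\lambda$-presentable and closed under (small) colimits in $\mathcal A$, the inclusion $\mathcal A_\lambda\to\mathcal A$ preserving colimits. Write $\mathcal A_\lambda^\lambda$ for the class of objects of $\mathcal A_\lambda$ that are $\lambda$-presentable in $\mathcal A_\lambda$. Let $\kappa$ be a regular cardinal. Suppose that: 1. the family is increasing from $\kappa$ on, in the sense that $\mathcal A_\mu^\mu\subseteq\mathcal A_\lambda^\lambda$ (and hence also $\mathcal A_\mu\subseteq\mathcal A_\lambda$) for all regular cardinals $\kappa\le\mu\le\lambda$; 2. $\mathcal A$ is \emph{weakly $\kappa$-generated}: the smallest full subcategory of $\mathcal A$ that contains $\mathcal A_\kappa$ and is closed under kernels, cokernels, extensions and countable coproducts is $\mathcal A$ itself; 3. for every regular cardinal $\lambda\ge\kappa$, every $X\in\mathcal A_\lambda^\lambda$ admits a monomorphism $X\to S$ in $\mathcal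 A$ into an object $S\in\mathcal A_\lambda^\lambda$ that is injective in $\mathcal A$. Then every exact contravariant functor $F:\mathcal A\to\mathrm{Ab}$ that sends coproducts to products is representable: there are an object $Z$ of $\mathcal A$ and a natural isomorphism of $\mathrm{Ab}$-valued functors $F\cong\mathcal A(-,Z)$. Moreover, every object representing $F$ is injective. -/

import Mathlib

universe w u

namespace QuasiLocPres

open CategoryTheory CategoryTheory.Limits

variable {A : Type u} [Category.{w} A]

/-- The family `𝒜` of full subcategories (only its values at regular cardinals matter) exhibits
`A` as a quasi-locally presentable category: for every regular cardinal `μ` the subcategory `𝒜 μ`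
is locally `μ`-presentable and closed under colimits in `A` (small colimits of objects of `𝒜 μ`,
formed in `A`, lie in `𝒜 μ`, and the inclusion functor preserves colimits), and every object
of `A` lies in some `𝒜 μ`. -/
structure IsQuasiLocallyPresentable (𝒜 : Cardinal.{w} → ObjectProperty A) : Prop where
  locallyPresentable (μ : Cardinal.{w}) [Fact μ.IsRegular] :
    IsCardinalLocallyPresentable (𝒜 μ).FullSubcategory μ
  closedUnderColimits (μ : Cardinal.{w}) [Fact μ.IsRegular] (J : Type w) [SmallCategory J] :
    (𝒜 μ).IsClosedUnderColimitsOfShape J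
  preservesColimits (μ : Cardinal.{w}) [Fact μ.IsRegular] :
    PreservesColimitsOfSize.{w, w} (𝒜 μ).ι
  exists_mem (X : A) : ∃ μ : Cardinal.{w}, μ.IsRegular ∧ 𝒜 μ X

/-- The objects of `𝒜 μ` that are `μ`-presentable in the category `𝒜 μ`. -/
def presentablePart (𝒜 : Cardinal.{w} → ObjectProperty A) (μ : Cardinal.{w})
    [Fact μ.IsRegular] : ObjectProperty A :=
  fun X => ∃ h : 𝒜 μ X, IsCardinalPresentable (⟨X, h⟩ : (𝒜 μ).FullSubcategory) μ

/-- The injective objects of `A` that lie in `𝒜 μ` and are `μ`-presentable there. -/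
def injectivePart (𝒜 : Cardinal.{w} → ObjectProperty A) (μ : Cardinal.{w})
    [Fact μ.IsRegular] : ObjectProperty A :=
  fun S => Injective S ∧ presentablePart 𝒜 μ S

/-- `A` coincides with its smallest full subcategory containing `𝒜 κ` and closed under kernels,
cokernels, extensions and countable coproducts. -/
def IsWeaklyGenerated [Abelian A] (𝒜 : Cardinal.{w} → ObjectProperty A) (κ : Cardinal.{w}) :
    Prop :=
  ∀ P : ObjectProperty A, 𝒜 κ ≤ P →
    P.IsClosedUnderKernels → P.IsClosedUnderCokernels → P.IsClosedUnderExtensions →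
    (∀ (J : Type) [Countable J], P.IsClosedUnderColimitsOfShape (Discrete J)) →
    ∀ X : A, P X

end QuasiLocPres

/-! The argument is of Brown representability type. A chain of pairs (S_j, s_j) with s_j ∈ F(S_j) is
built along ω₁: the first element induces all elements over a small set of generators G_i of `𝒜 κ`,
and each successor stage is injective and kills the maps from the G_i along which the previous
element vanishes (`exists_injective_annihilating`, `exists_elementSystem`).

The objects X with colim_j A(X, S_j) ≅ F(X), i.e. those in `detects`, include `𝒜 κ`
(`detects_of_colimitPresentation`). They are closed under cokernels by exactness, under kernels and
extensions because injective stages are cofinal, and under countable coproducts because ω₁ has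
uncountable cofinality. Weak generation thus gives every object, including the colimit of the chain
itself. There the canonical element produces an idempotent, and its image represents F
(`exists_iso_preadditiveYoneda`). Injectivity of Z is exactness of A(-, Z). -/

namespace QuasiLocPres

open CategoryTheory CategoryTheory.Limits Opposite

/-! ### Small colimits of presentable objects. -/

section Presentable

variable {A : Type u} [Category.{w} A] {𝒜 : Cardinal.{w} → ObjectProperty A}

/-- The objects of `A` that are `μ`-presentable in `𝒜 μ` for some regular cardinal `μ ≥ κ`. -/
def eventuallyPresentable (𝒜 : Cardinal.{w} → ObjectProperty A) (κ : Cardinal.{w}) :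
    ObjectProperty A :=
  fun X => ∃ (μ : Cardinal.{w}) (_ : Fact μ.IsRegular), κ ≤ μ ∧ presentablePart 𝒜 μ X

lemma presentablePart_of_isColimit (hA : IsQuasiLocallyPresentable 𝒜) (μ : Cardinal.{w})
    [Fact μ.IsRegular] {J : Type w} [SmallCategory J] (hJ : HasCardinalLT (Arrow J) μ)
    {D : J ⥤ A} {c : Cocone D} (hc : IsColimit c) (hD : ∀ j, presentablePart 𝒜 μ (D.obj j)) :
    presentablePart 𝒜 μ c.pt := by
  have := hA.closedUnderColimits μ J
  have := hA.locallyPresentable μ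
  choose h₁ h₂ using hD
  have hX : 𝒜 μ c.pt := (𝒜 μ).prop_of_isColimit hc h₁
  let D' : J ⥤ (𝒜 μ).FullSubcategory := (𝒜 μ).lift D h₁
  let c' : Cocone D' :=
    { pt := ⟨c.pt, hX⟩
      ι := { app := fun j => ObjectProperty.homMk (c.ι.app j)
             naturality := fun i j f => by
              ext
              exact c.ι.naturality f } }
  have hc' : IsColimit c' := isColimitOfReflects (𝒜 μ).ι (c := c') hc
  have : ∀ j, IsCardinalPresentable (D'.obj j) μ := h₂
  exact ⟨hX, isCardinalPresentable_of_isColimit c' hc' μ hJ⟩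

lemma hasColimit_of_forall_mem (hA : IsQuasiLocallyPresentable 𝒜) (μ : Cardinal.{w})
    [Fact μ.IsRegular] {J : Type w} [SmallCategory J] (D : J ⥤ A) (hD : ∀ j, 𝒜 μ (D.obj j)) :
    HasColimit D := by
  have := hA.locallyPresentable μ
  have := hA.preservesColimits μ
  let D' : J ⥤ (𝒜 μ).FullSubcategory := (𝒜 μ).lift D hD
  exact ⟨⟨⟨(𝒜 μ).ι.mapCocone (colimit.cocone D'),
    isColimitOfPreserves (𝒜 μ).ι (colimit.isColimit D')⟩⟩⟩

variable {κ : Cardinal.{w}}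

/-- A small family lives at a single level. Taking `T` to be the arrow type of a diagram also bounds
the diagram by `μ`, as closure of `μ`-presentable objects under colimits requires. -/
lemma exists_forall_presentablePart
    (hinc : ∀ (μ ν : Cardinal.{w}) [Fact μ.IsRegular] [Fact ν.IsRegular], κ ≤ μ → μ ≤ ν →
      presentablePart 𝒜 μ ≤ presentablePart 𝒜 ν)
    {J : Type w} (D : J → A) (hD : ∀ j, eventuallyPresentable 𝒜 κ (D j)) (T : Type w) :
    ∃ (μ : Cardinal.{w}) (_ : Fact μ.IsRegular), κ ≤ μ ∧ HasCardinalLT T μ ∧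
      ∀ j, presentablePart 𝒜 μ (D j) := by
  choose m hm h₁ h₂ using hD
  obtain ⟨ν, hν, h⟩ := HasCardinalLT.exists_regular_cardinal_forall.{w}
    (Sum.elim (Sum.elim (fun (_ : PUnit.{w + 1}) ↦ T) (fun _ : PUnit.{w + 1} ↦ κ.ord.ToType))
      (fun j : J ↦ (m j).ord.ToType))
  have : Fact ν.IsRegular := ⟨hν⟩
  refine ⟨ν, this, ?_, h (Sum.inl (Sum.inl ⟨⟩)), fun j => ?_⟩
  · exact le_of_lt (by simpa [hasCardinalLT_iff_cardinal_mk_lt] using h (Sum.inl (Sum.inr ⟨⟩)))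
  · exact hinc (m j) ν (h₁ j)
      (le_of_lt (by simpa [hasCardinalLT_iff_cardinal_mk_lt] using h (Sum.inr j))) _ (h₂ j)

lemma hasColimit_of_eventuallyPresentable (hA : IsQuasiLocallyPresentable 𝒜)
    (hinc : ∀ (μ ν : Cardinal.{w}) [Fact μ.IsRegular] [Fact ν.IsRegular], κ ≤ μ → μ ≤ ν →
      presentablePart 𝒜 μ ≤ presentablePart 𝒜 ν)
    {J : Type w} [SmallCategory J] (D : J ⥤ A)
    (hD : ∀ j, eventuallyPresentable 𝒜 κ (D.obj j)) : HasColimit D := by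
  obtain ⟨μ, _, -, -, h⟩ := exists_forall_presentablePart hinc D.obj hD PUnit
  exact hasColimit_of_forall_mem hA μ D fun j => (h j).1

lemma isClosedUnderColimits_eventuallyPresentable (hA : IsQuasiLocallyPresentable 𝒜)
    (hinc : ∀ (μ ν : Cardinal.{w}) [Fact μ.IsRegular] [Fact ν.IsRegular], κ ≤ μ → μ ≤ ν →
      presentablePart 𝒜 μ ≤ presentablePart 𝒜 ν)
    (J : Type w) [SmallCategory J] :
    (eventuallyPresentable 𝒜 κ).IsClosedUnderColimitsOfShape J where
  colimitsOfShape_le := by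
    rintro X ⟨p⟩
    obtain ⟨μ, hμ, hκ, hT, h⟩ :=
      exists_forall_presentablePart hinc p.diag.obj p.prop_diag_obj (Arrow J)
    exact ⟨μ, hμ, hκ, presentablePart_of_isColimit hA μ hT p.isColimit h⟩

/-- Every object of `𝒜 κ` is a small colimit, in `A`, of objects from a fixed small
collection of objects that are `κ`-presentable in `𝒜 κ`. -/
lemma exists_small_generator [Fact κ.IsRegular] (hA : IsQuasiLocallyPresentable 𝒜) :
    ∃ (I : Type w) (G : I → A), (∀ i, presentablePart 𝒜 κ (G i)) ∧
      ∀ X, 𝒜 κ X → ∃ (J : Type w) (_ : SmallCategory J) (p : ColimitPresentation J X),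
        ∀ j, ∃ i, p.diag.obj j = G i := by
  have := hA.locallyPresentable κ
  have := hA.preservesColimits κ
  obtain ⟨Q, hQ, h⟩ :=
    HasCardinalFilteredGenerator.exists_small_generator (𝒜 κ).FullSubcategory κ
  have : Small.{w} (Subtype Q) := hQ
  refine ⟨Shrink.{w} (Subtype Q), fun i => ((equivShrink _).symm i).1.obj, fun i => ?_, ?_⟩
  · exact ⟨_, h.le_isCardinalPresentable _ ((equivShrink _).symm i).2⟩
  · intro X hX
    obtain ⟨J, _, _, ⟨p⟩⟩ := h.exists_colimitsOfShape ⟨X, hX⟩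
    refine ⟨J, inferInstance, p.toColimitPresentation.map (𝒜 κ).ι, fun j =>
      ⟨equivShrink _ ⟨_, p.prop_diag_obj j⟩, ?_⟩⟩
    simp

lemma hasColimits_eventuallyPresentable (hA : IsQuasiLocallyPresentable 𝒜)
    (hinc : ∀ (μ ν : Cardinal.{w}) [Fact μ.IsRegular] [Fact ν.IsRegular], κ ≤ μ → μ ≤ ν →
      presentablePart 𝒜 μ ≤ presentablePart 𝒜 ν) :
    HasColimitsOfSize.{w, w} (eventuallyPresentable 𝒜 κ).FullSubcategory ∧
      PreservesColimitsOfSize.{w, w} (eventuallyPresentable 𝒜 κ).ι := by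
  have key {J : Type w} [SmallCategory J] (D : J ⥤ (eventuallyPresentable 𝒜 κ).FullSubcategory) :
      HasColimit D ∧ PreservesColimit D (eventuallyPresentable 𝒜 κ).ι := by
    have := isClosedUnderColimits_eventuallyPresentable hA hinc J
    have : HasColimit (D ⋙ (eventuallyPresentable 𝒜 κ).ι) :=
      hasColimit_of_eventuallyPresentable hA hinc _ fun j => (D.obj j).property
    have := createsColimitFullSubcategoryInclusion D
      ((eventuallyPresentable 𝒜 κ).prop_colimit (D ⋙ (eventuallyPresentable 𝒜 κ).ι)
        fun j => (D.obj j).property)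
    exact ⟨hasColimit_of_created D (eventuallyPresentable 𝒜 κ).ι, inferInstance⟩
  exact ⟨⟨fun J _ => ⟨fun D => (key D).1⟩⟩, ⟨fun {J} _ => ⟨fun {D} => (key D).2⟩⟩⟩

end Presentable

/-! ### Elements of an exact contravariant functor. -/

section Pull

variable {A : Type u} [Category.{w} A] (F : Aᵒᵖ ⥤ AddCommGrpCat.{w})

/-- The action of a morphism on the values of a contravariant functor to abelian groups. -/
def pull {X Y : A} (f : X ⟶ Y) : F.obj (op Y) →+ F.obj (op X) := (F.map f.op).hom

@[simp]
lemma pull_id {X : A} (x : F.obj (op X)) : pull F (𝟙 X) x = x := by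
  simp [pull]

@[simp]
lemma pull_comp {X Y Z : A} (f : X ⟶ Y) (g : Y ⟶ Z) (x : F.obj (op Z)) :
    pull F (f ≫ g) x = pull F f (pull F g x) := by
  simp [pull]

lemma eq_zero_of_pull_isColimit {J : Type*} [Category* J] {D : J ⥤ A} {c : Cocone D}
    (hc : IsColimit c) [PreservesLimitsOfShape Jᵒᵖ F] (x : F.obj (op c.pt))
    (hx : ∀ j, pull F (c.ι.app j) x = 0) : x = 0 := by
  refine Concrete.isLimit_ext _ (isLimitOfPreserves F hc.op) x 0 fun j => ?_
  rw [map_zero]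
  exact hx j.unop

lemma pull_injective [PreservesFiniteLimits F] {X Y : A} (f : X ⟶ Y) [Epi f] :
    Function.Injective (pull F f) :=
  (AddCommGrpCat.mono_iff_injective (F.map f.op)).1 inferInstance

lemma pull_surjective [PreservesFiniteColimits F] {X Y : A} (f : X ⟶ Y) [Mono f] :
    Function.Surjective (pull F f) :=
  (AddCommGrpCat.epi_iff_surjective (F.map f.op)).1 inferInstance

variable [Abelian A]

section Additive

variable [F.Additive]

@[simp]
lemma pull_add_hom {X Y : A} (f g : X ⟶ Y) (x : F.obj (op Y)) :
    pull F (f + g) x = pull F f x + pull F g x := by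
  simp [pull]

@[simp]
lemma pull_sub_hom {X Y : A} (f g : X ⟶ Y) (x : F.obj (op Y)) :
    pull F (f - g) x = pull F f x - pull F g x := by
  simp [pull]

@[simp]
lemma pull_zero_hom {X Y : A} (x : F.obj (op Y)) :
    pull F (0 : X ⟶ Y) x = 0 := by
  simp [pull]

end Additive

lemma exists_pull_eq_of_exact [F.Additive] [PreservesFiniteLimits F] [PreservesFiniteColimits F]
    {S : ShortComplex A} (hS : S.Exact) (x : F.obj (op S.X₂)) (hx : pull F S.f x = 0) :
    ∃ y, pull F S.g y = x :=
  (ShortComplex.ab_exact_iff _).1 (hS.op.map F) x hx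

end Pull

/-! ### Systems of elements and closure properties of detected objects. -/

/-- A diagram in `A` over a preorder together with a compatible family of elements of the values
of a contravariant functor `F`. -/
structure ElementSystem {A : Type u} [Category.{w} A] (F : Aᵒᵖ ⥤ AddCommGrpCat.{w})
    (J : Type w) [Preorder J] where
  /-- the underlying diagram -/
  diag : J ⥤ A
  /-- the compatible family of elements -/
  elt (j : J) : F.obj (op (diag.obj j))
  pull_elt {i j : J} (f : i ⟶ j) : pull F (diag.map f) (elt j) = elt i

namespace ElementSystem

variable {A : Type u} [Category.{w} A] [Abelian A] {F : Aᵒᵖ ⥤ AddCommGrpCat.{w}}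
  {J : Type w} [Preorder J] (σ : ElementSystem F J)

attribute [simp] pull_elt

/-- The objects `X` for which the canonical map from the colimit of the groups
`X ⟶ σ.diag.obj j` to `F.obj (op X)` is bijective. -/
def detects : ObjectProperty A := fun X =>
  (∀ x : F.obj (op X), ∃ (i : J) (f : X ⟶ σ.diag.obj i), pull F f (σ.elt i) = x) ∧
  ∀ (i : J) (f : X ⟶ σ.diag.obj i), pull F f (σ.elt i) = 0 →
    ∃ (j : J) (g : i ⟶ j), f ≫ σ.diag.map g = 0

section

variable {σ} [F.Additive]

lemma detects.exists_comp_eq [IsDirectedOrder J] {X : A} (hX : σ.detects X) {i j : J} (f : X ⟶ σ.diag.obj i)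
    (g : X ⟶ σ.diag.obj j) (h : pull F f (σ.elt i) = pull F g (σ.elt j)) :
    ∃ (k : J) (a : i ⟶ k) (b : j ⟶ k), f ≫ σ.diag.map a = g ≫ σ.diag.map b := by
  obtain ⟨l, hi, hj⟩ := exists_ge_ge i j
  obtain ⟨k, c, hc⟩ := hX.2 l (f ≫ σ.diag.map (homOfLE hi) - g ≫ σ.diag.map (homOfLE hj))
    (by simp [h])
  refine ⟨k, homOfLE hi ≫ c, homOfLE hj ≫ c, ?_⟩
  simpa [Preadditive.sub_comp, sub_eq_zero] using hc

variable [PreservesFiniteLimits F]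

/-- Both F and the filtered colimit of the functors A(-, S_j) turn cokernels into kernels, so no
injectivity is needed. -/
lemma detects_of_isColimit_cokernelCofork {X Y : A} {f : X ⟶ Y} {c : CokernelCofork f}
    (hc : IsColimit c) (hX : σ.detects X) (hY : σ.detects Y) : σ.detects c.pt := by
  have : Epi c.π := Cofork.IsColimit.epi hc
  refine ⟨fun x => ?_, fun i g hg => ?_⟩
  · obtain ⟨i, k, hk⟩ := hY.1 (pull F c.π x)
    obtain ⟨j, t, ht⟩ := hX.2 i (f ≫ k) (by
      rw [pull_comp, hk, ← pull_comp, c.condition, pull_zero_hom])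
    obtain ⟨l, hl⟩ := CokernelCofork.IsColimit.desc' hc (k ≫ σ.diag.map t) (by simpa using ht)
    refine ⟨j, l, pull_injective F c.π ?_⟩
    rw [← pull_comp, hl, pull_comp, pull_elt, hk]
  · obtain ⟨j, t, ht⟩ := hY.2 i (c.π ≫ g) (by rw [pull_comp, hg, map_zero])
    exact ⟨j, t, by rw [← cancel_epi c.π, comp_zero, ← ht, Category.assoc]⟩

variable [IsDirectedOrder J] [PreservesFiniteColimits F]

/-- Elements over the kernel extend by exactness of F. For a map whose element vanishes, an
injective stage extends it to `X`; the resulting element then comes from `Y`, so at a later stage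
the extension factors through `f` and dies on the kernel. -/
lemma detects_of_isLimit_kernelFork
    (hinj : ∀ i : J, ∃ j, i ≤ j ∧ Injective (σ.diag.obj j))
    {X Y : A} {f : X ⟶ Y} {c : KernelFork f}
    (hc : IsLimit c) (hX : σ.detects X) (hY : σ.detects Y) : σ.detects c.pt := by
  have : Mono c.ι := Fork.IsLimit.mono hc
  refine ⟨fun x => ?_, fun i g hg => ?_⟩
  · obtain ⟨y, rfl⟩ := pull_surjective F c.ι x
    obtain ⟨i, k, rfl⟩ := hX.1 y
    exact ⟨i, c.ι ≫ k, by simp⟩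
  · obtain ⟨j, hij, hj⟩ := hinj i
    let g' := Injective.factorThru (g ≫ σ.diag.map (homOfLE hij)) c.ι
    have hg' : c.ι ≫ g' = g ≫ σ.diag.map (homOfLE hij) := Injective.comp_factorThru _ _
    have hS : (ShortComplex.mk c.ι f c.condition).Exact :=
      ShortComplex.exact_of_f_is_kernel _
        (IsLimit.ofIsoLimit hc (Fork.ext (Iso.refl _) (by simp)))
    obtain ⟨y, hy⟩ := exists_pull_eq_of_exact F hS (pull F g' (σ.elt j)) (by
      dsimp
      rw [← pull_comp, hg', pull_comp, pull_elt, hg])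
    obtain ⟨l, k, rfl⟩ := hY.1 y
    obtain ⟨m, a, b, hab⟩ := hX.exists_comp_eq g' (f ≫ k) (by rw [pull_comp, ← hy])
    refine ⟨m, homOfLE hij ≫ a, ?_⟩
    rw [Functor.map_comp, ← Category.assoc, ← hg', Category.assoc, hab, Category.assoc,
      c.condition_assoc, zero_comp]

lemma detects_of_shortExact
    (hinj : ∀ i : J, ∃ j, i ≤ j ∧ Injective (σ.diag.obj j))
    {S : ShortComplex A} (hS : S.ShortExact) (h₁ : σ.detects S.X₁) (h₃ : σ.detects S.X₃) :
    σ.detects S.X₂ := by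
  have := hS.mono_f
  have := hS.epi_g
  refine ⟨fun x => ?_, fun i f hf => ?_⟩
  · obtain ⟨i, a, ha⟩ := h₁.1 (pull F S.f x)
    obtain ⟨j, hij, hj⟩ := hinj i
    let a' := Injective.factorThru (a ≫ σ.diag.map (homOfLE hij)) S.f
    have ha' : S.f ≫ a' = a ≫ σ.diag.map (homOfLE hij) := Injective.comp_factorThru _ _
    obtain ⟨y, hy⟩ := exists_pull_eq_of_exact F hS.exact (x - pull F a' (σ.elt j)) (by
      rw [map_sub, ← pull_comp, ha', pull_comp, pull_elt, ha, sub_self])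
    obtain ⟨k, b, rfl⟩ := h₃.1 y
    obtain ⟨l, hj, hk⟩ := exists_ge_ge j k
    -- The extension `a'` has the right restriction to the subobject; the error comes from the
    -- quotient and is corrected by `b`.
    refine ⟨l, a' ≫ σ.diag.map (homOfLE hj) + (S.g ≫ b) ≫ σ.diag.map (homOfLE hk), ?_⟩
    simp [hy]
  · obtain ⟨j, t, ht⟩ := h₁.2 i (S.f ≫ f) (by rw [pull_comp, hf, map_zero])
    obtain ⟨g, hg⟩ := CokernelCofork.IsColimit.desc' hS.gIsCokernel (f ≫ σ.diag.map t)
      (by simpa using ht)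
    replace hg : S.g ≫ g = f ≫ σ.diag.map t := hg
    obtain ⟨k, s, hs⟩ := h₃.2 j g (pull_injective F S.g (by
      rw [← pull_comp, hg, pull_comp, pull_elt, hf, map_zero]))
    exact ⟨k, t ≫ s, by rw [Functor.map_comp, ← Category.assoc, ← hg, Category.assoc, hs,
      comp_zero]⟩

end

lemma detects_of_isColimit_discrete [F.Additive]
    (hJ : ∀ (I : Type) [Countable I] (k : I → J), ∃ j, ∀ i, k i ≤ j)
    (hF : ∀ I : Type w, PreservesLimitsOfShape (Discrete I) F)
    {I : Type} [Countable I] {D : Discrete I ⥤ A} {c : Cocone D} (hc : IsColimit c)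
    (hD : ∀ i, σ.detects (D.obj i)) : σ.detects c.pt := by
  have := hF (ULift I)
  have : PreservesLimitsOfShape (Discrete I)ᵒᵖ F := preservesLimitsOfShape_of_equiv
    ((Discrete.equivalence Equiv.ulift).trans (Discrete.opposite I).symm) F
  refine ⟨fun x => ?_, fun i f hf => ?_⟩
  · choose k f hf using fun i => (hD i).1 (pull F (c.ι.app i) x)
    obtain ⟨j, hj⟩ : ∃ j, ∀ i, k i ≤ j :=
      (hJ I fun i => k ⟨i⟩).imp fun j hj i => hj i.as
    let g : c.pt ⟶ σ.diag.obj j := hc.desc (Cocone.mk _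
      { app := fun i => f i ≫ σ.diag.map (homOfLE (hj i))
        naturality := by
          rintro ⟨i⟩ ⟨i'⟩ t
          obtain rfl : i = i' := Discrete.eq_of_hom t
          obtain rfl : t = 𝟙 _ := Subsingleton.elim _ _
          simp })
    have hg (i) : c.ι.app i ≫ g = f i ≫ σ.diag.map (homOfLE (hj i)) := hc.fac _ i
    refine ⟨j, g, ?_⟩
    rw [← sub_eq_zero]
    refine eq_zero_of_pull_isColimit F hc _ fun i => ?_
    rw [map_sub, ← pull_comp, hg, pull_comp, pull_elt, hf, sub_self]
  · choose k t ht using fun l => (hD l).2 i (c.ι.app l ≫ f) (by rw [pull_comp, hf, map_zero])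
    -- `Option I` adjoins `i` to the countable family to be bounded.
    obtain ⟨j, hij, hj⟩ : ∃ j, i ≤ j ∧ ∀ l, k l ≤ j :=
      (hJ (Option I) fun o => o.elim i fun l => k ⟨l⟩).imp
        fun j hj => ⟨hj none, fun l => hj (some l.as)⟩
    refine ⟨j, homOfLE hij, hc.hom_ext fun l => ?_⟩
    rw [comp_zero, Subsingleton.elim (homOfLE hij) (t l ≫ homOfLE (hj l)), Functor.map_comp]
    simpa using ht l =≫ σ.diag.map (homOfLE (hj l))

/-- If a system detects every object and the elements of the system come from a cocone, then `F`
is representable: the cocone point carries an idempotent whose image represents `F`. -/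
lemma exists_iso_preadditiveYoneda [F.Additive] (h : ∀ X, σ.detects X) (c : Cocone σ.diag)
    (t : F.obj (op c.pt)) (ht : ∀ j, pull F (c.ι.app j) t = σ.elt j) :
    ∃ Z : A, Nonempty (F ≅ preadditiveYoneda.obj Z) := by
  obtain ⟨i, f, hf⟩ := (h c.pt).1 t
  let e : c.pt ⟶ c.pt := f ≫ c.ι.app i
  have het : pull F e t = t := by simp [e, ht, hf]
  -- `e` kills whatever `t` does not see: `g ≫ f` dies at some later stage `j`, through which the
  -- cocone map from `i` factors.
  have key {X : A} (g : X ⟶ c.pt) (hg : pull F g t = 0) : g ≫ e = 0 := by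
    obtain ⟨j, a, ha⟩ := (h X).2 i (g ≫ f) (by rw [pull_comp, hf, hg])
    simp only [e]
    rw [← c.w a]
    simpa using ha =≫ c.ι.app j
  have hee : e ≫ e = e := by
    have := key (e - 𝟙 _) (by simp [het])
    simpa [Preadditive.sub_comp, sub_eq_zero] using this
  obtain ⟨Z, m, p, hmp, hpm⟩ := IsIdempotentComplete.idempotents_split c.pt e hee
  have hbij (X : A) : Function.Bijective (fun g : X ⟶ Z => pull F g (pull F m t)) := by
    refine ⟨fun g g' hgg => ?_, fun x => ?_⟩
    · have := key ((g - g') ≫ m) (by simpa [sub_eq_zero] using hgg)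
      rw [← hpm, Category.assoc, reassoc_of% hmp, Preadditive.sub_comp, sub_eq_zero] at this
      simpa [hmp] using this =≫ p
    · obtain ⟨j, g, rfl⟩ := (h X).1 x
      refine ⟨g ≫ c.ι.app j ≫ p, ?_⟩
      dsimp
      rw [← pull_comp, Category.assoc, Category.assoc, hpm, pull_comp, pull_comp, het, ht]
  let φ (X : Aᵒᵖ) : (preadditiveYoneda.obj Z).obj X ≅ F.obj X :=
    AddEquiv.toAddCommGrpIso (X := (preadditiveYoneda.obj Z).obj X)
      (AddEquiv.ofBijective (AddMonoidHom.mk' (fun g : X.unop ⟶ Z => pull F g (pull F m t))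
        fun g g' => pull_add_hom F g g' _) (hbij X.unop))
  refine ⟨Z, ⟨(NatIso.ofComponents φ ?_).symm⟩⟩
  intro X Y a
  ext g
  exact pull_comp F a.unop g _

end ElementSystem

/-! ### Detection of colimits of generators, and the successor step. -/

section Chain

variable {A : Type u} [Category.{w} A] {F : Aᵒᵖ ⥤ AddCommGrpCat.{w}}

lemma eq_zero_of_pull_sigma_ι (hF : ∀ I : Type w, PreservesLimitsOfShape (Discrete I) F)
    {I : Type w} (G : I → A) [HasCoproduct G] (x : F.obj (op (∐ G)))
    (hx : ∀ i, pull F (Sigma.ι G i) x = 0) : x = 0 := by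
  have := hF I
  have : PreservesLimitsOfShape (Discrete I)ᵒᵖ F :=
    preservesLimitsOfShape_of_equiv (Discrete.opposite I).symm F
  exact eq_zero_of_pull_isColimit F (coproductIsCoproduct G) x fun i => hx i.as

lemma eq_zero_of_pull_isColimit_of_hasCoproduct [PreservesFiniteLimits F]
    (hF : ∀ I : Type w, PreservesLimitsOfShape (Discrete I) F)
    {J : Type w} [SmallCategory J] {D : J ⥤ A} [HasCoproduct D.obj] {c : Cocone D}
    (hc : IsColimit c) (x : F.obj (op c.pt)) (hx : ∀ j, pull F (c.ι.app j) x = 0) : x = 0 := by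
  let q : ∐ D.obj ⟶ c.pt := Sigma.desc fun j => c.ι.app j
  have : Epi q := ⟨fun u v huv => hc.hom_ext fun j => by
    simpa [q] using Sigma.ι D.obj j ≫= huv⟩
  refine pull_injective F q ?_
  rw [map_zero]
  refine eq_zero_of_pull_sigma_ι hF _ _ fun j => ?_
  rw [← pull_comp, Sigma.ι_desc, hx]

variable [Abelian A]

/-- A system which absorbs all elements over a family of objects, and annihilates at a later stage
all morphisms from these objects along which its elements vanish, detects all colimits of these
objects. -/
lemma ElementSystem.detects_of_colimitPresentation [F.Additive] [PreservesFiniteLimits F]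
    (hF : ∀ I : Type w, PreservesLimitsOfShape (Discrete I) F)
    {J : Type w} [Preorder J] (σ : ElementSystem F J) {I : Type w} {G : I → A} (i₀ : J)
    (h₀ : ∀ (i : I) (x : F.obj (op (G i))), ∃ f : G i ⟶ σ.diag.obj i₀, pull F f (σ.elt i₀) = x)
    (hkill : ∀ j : J, ∃ (k : J) (a : j ⟶ k), ∀ (i : I) (f : G i ⟶ σ.diag.obj j),
      pull F f (σ.elt j) = 0 → f ≫ σ.diag.map a = 0)
    {X : A} {K : Type w} [SmallCategory K] (p : ColimitPresentation K X)
    [HasCoproduct p.diag.obj] (hp : ∀ k, ∃ i, p.diag.obj k = G i) : σ.detects X := by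
  have h₀' (k : K) (x : F.obj (op (p.diag.obj k))) :
      ∃ f : p.diag.obj k ⟶ σ.diag.obj i₀, pull F f (σ.elt i₀) = x := by
    obtain ⟨i, hi⟩ := hp k
    generalize p.diag.obj k = Y at hi x
    subst hi
    exact h₀ i x
  have hkill' (j : J) : ∃ (k : J) (a : j ⟶ k), ∀ (l : K) (f : p.diag.obj l ⟶ σ.diag.obj j),
      pull F f (σ.elt j) = 0 → f ≫ σ.diag.map a = 0 := by
    obtain ⟨k, a, ha⟩ := hkill j
    refine ⟨k, a, fun l f => ?_⟩
    obtain ⟨i, hi⟩ := hp l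
    generalize p.diag.obj l = Y at hi f
    subst hi
    exact ha i f
  refine ⟨fun x => ?_, fun j f hf => ?_⟩
  -- The chosen maps are compatible only up to maps along which the element vanishes; one later
  -- stage kills all these discrepancies at once.
  · choose f hf using fun k => h₀' k (pull F (p.ι.app k) x)
    obtain ⟨k, a, ha⟩ := hkill' i₀
    let g : X ⟶ σ.diag.obj k := p.isColimit.desc (Cocone.mk _
      { app := fun l => f l ≫ σ.diag.map a
        naturality := fun l l' u => by
          have := ha l (p.diag.map u ≫ f l' - f l) (by
            rw [pull_sub_hom, pull_comp, hf, hf, ← pull_comp, p.ι.naturality]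
            simp)
          simpa [Preadditive.sub_comp, sub_eq_zero] using this })
    have hg (l : K) : p.ι.app l ≫ g = f l ≫ σ.diag.map a := p.isColimit.fac _ l
    refine ⟨k, g, ?_⟩
    rw [← sub_eq_zero]
    refine eq_zero_of_pull_isColimit_of_hasCoproduct hF p.isColimit _ fun l => ?_
    dsimp
    rw [map_sub, ← pull_comp, hg, pull_comp, σ.pull_elt, hf, sub_self]
  · obtain ⟨k, a, ha⟩ := hkill' j
    refine ⟨k, a, p.isColimit.hom_ext fun l => ?_⟩
    dsimp
    rw [comp_zero, ← Category.assoc]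
    exact ha l _ (by rw [pull_comp, hf, map_zero])

/-- Every element over an object of `P` is induced from an element over an injective object of `P`
such that all morphisms from the given objects along which the element vanishes become zero. -/
lemma exists_injective_annihilating [F.Additive] [PreservesFiniteLimits F]
    [PreservesFiniteColimits F] (hF : ∀ I : Type w, PreservesLimitsOfShape (Discrete I) F)
    (P : ObjectProperty A) [∀ (J : Type w) [SmallCategory J], P.IsClosedUnderColimitsOfShape J]
    (hcolim : ∀ (J : Type w) [SmallCategory J] (D : J ⥤ A), (∀ j, P (D.obj j)) → HasColimit D)
    (hinj : ∀ X : A, P X → ∃ (S : A) (f : X ⟶ S), P S ∧ Injective S ∧ Mono f)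
    {I : Type w} {G : I → A} (hG : ∀ i, P (G i)) (C : A) (hC : P C) (c : F.obj (op C)) :
    ∃ (S : A) (s : F.obj (op S)) (g : C ⟶ S), P S ∧ Injective S ∧ pull F g s = c ∧
      ∀ (i : I) (f : G i ⟶ C), pull F f c = 0 → f ≫ g = 0 := by
  -- All maps to be killed form a small set; their joint cokernel, embedded in an injective, is the
  -- new object. The element descends to it and then extends.
  let K : Type w := Σ i : I, { f : G i ⟶ C // pull F f c = 0 }
  let W : K → A := fun k => G k.1
  have : HasCoproduct W := hcolim _ _ fun k => hG _
  have hW : P (∐ W) := P.prop_colimit _ fun k => hG _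
  let d : ∐ W ⟶ C := Sigma.desc fun k => k.2.1
  have hd : pull F d c = 0 := eq_zero_of_pull_sigma_ι hF _ _ fun k => by
    rw [← pull_comp, Sigma.ι_desc, k.2.2]
  have : P.IsClosedUnderColimitsOfShape WalkingParallelPair :=
    .of_equivalence (AsSmall.equiv.{_, _, w} (C := WalkingParallelPair)).symm
  have hQ : P (cokernel d) :=
    P.prop_colimit _ (by rintro (_ | _); exacts [hW, hC])
  obtain ⟨q, hq⟩ := exists_pull_eq_of_exact F
    (ShortComplex.exact_of_g_is_cokernel (ShortComplex.mk d (cokernel.π d) (cokernel.condition d))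
      (cokernelIsCokernel d)) c hd
  obtain ⟨S, m, hS, hSi, hm⟩ := hinj _ hQ
  obtain ⟨s, rfl⟩ := pull_surjective F m q
  refine ⟨S, s, cokernel.π d ≫ m, hS, hSi, by rw [pull_comp]; exact hq, fun i f hf => ?_⟩
  have h₁ : f = Sigma.ι W ⟨i, f, hf⟩ ≫ d := 
    (Sigma.ι_desc (fun k : K => k.2.1) ⟨i, f, hf⟩).symm
  rw [h₁, Category.assoc, cokernel.condition_assoc, zero_comp, comp_zero]

end Chain

/-! ### Transfinite iteration in the category of elements. -/

section Iteration

variable {A : Type u} [Category.{w} A]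

/-- The restriction of `F` to a full subcategory, as a presheaf of sets. -/
abbrev restrict (F : Aᵒᵖ ⥤ AddCommGrpCat.{w}) (P : ObjectProperty A) :
    P.FullSubcategoryᵒᵖ ⥤ Type w :=
  P.ι.op ⋙ F ⋙ forget AddCommGrpCat

variable {F : Aᵒᵖ ⥤ AddCommGrpCat.{w}} {P : ObjectProperty A}

/-- Coproducts and coequalizers generate all small colimits. Hence the category of elements has
small limits, and its opposite the colimits needed at limit stages. -/
lemma preservesLimits_restrict [PreservesFiniteLimits F]
    (hF : ∀ I : Type w, PreservesLimitsOfShape (Discrete I) F)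
    [HasColimitsOfSize.{w, w} P.FullSubcategory] [PreservesColimitsOfSize.{w, w} P.ι] :
    PreservesLimitsOfSize.{w, w} (restrict F P) := by
  have : PreservesLimitsOfSize.{w, w} P.ι.op := preservesLimitsOfSize_op _
  have : PreservesLimitsOfSize.{0, 0} P.ι.op := preservesLimitsOfSize_shrink.{0, w, 0, w} _
  have : HasCoequalizers P.FullSubcategory :=
    have := hasColimitsOfSizeShrink.{0, 0, w, w} P.FullSubcategory
    inferInstance
  have : HasCoproducts.{w} P.FullSubcategory := fun J => inferInstance
  have : PreservesLimitsOfSize.{w, w} (P.ι.op ⋙ F) :=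
    preservesLimits_of_preservesEqualizers_and_products _
  exact inferInstanceAs (PreservesLimitsOfSize.{w, w} ((P.ι.op ⋙ F) ⋙ forget AddCommGrpCat))

/-- The object of `A` underlying an object of the category of elements. -/
abbrev elementsObj (e : (restrict F P).Elementsᵒᵖ) : A := e.unop.1.unop.obj

/-- The element underlying an object of the category of elements. -/
abbrev elementsElt (e : (restrict F P).Elementsᵒᵖ) : F.obj (op (elementsObj e)) := e.unop.2

/-- The forgetful functor from the category of elements. -/
abbrev elementsForget (F : Aᵒᵖ ⥤ AddCommGrpCat.{w}) (P : ObjectProperty A) :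
    (restrict F P).Elementsᵒᵖ ⥤ A :=
  (CategoryOfElements.π (restrict F P)).leftOp ⋙ P.ι

lemma pull_elementsForget_map {e e' : (restrict F P).Elementsᵒᵖ} (f : e ⟶ e') :
    pull F ((elementsForget F P).map f) (elementsElt e') = elementsElt e :=
  f.unop.2

/-- Objects of the category of elements. -/
abbrev elementsMk (X : A) (hX : P X) (x : F.obj (op X)) : (restrict F P).Elementsᵒᵖ :=
  op ⟨op ⟨X, hX⟩, x⟩

/-- Morphisms of the category of elements. -/
abbrev elementsHomMk {e e' : (restrict F P).Elementsᵒᵖ} (f : elementsObj e ⟶ elementsObj e')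
    (hf : pull F f (elementsElt e') = elementsElt e) : e ⟶ e' :=
  Quiver.Hom.op ⟨Quiver.Hom.op (ObjectProperty.homMk f), hf⟩

/-- Iterating a successor operation on elements of `F`, starting from an element which induces all
elements over a given family of objects. -/
lemma exists_elementSystem [HasZeroMorphisms A] [PreservesFiniteLimits F]
    (hF : ∀ I : Type w, PreservesLimitsOfShape (Discrete I) F)
    [HasColimitsOfSize.{w, w} P.FullSubcategory] [PreservesColimitsOfSize.{w, w} P.ι]
    {I : Type w} {G : I → A} (hG : ∀ i, P (G i))
    (hstep : ∀ (C : A), P C → ∀ (c : F.obj (op C)),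
      ∃ (S : A) (s : F.obj (op S)) (g : C ⟶ S), P S ∧ Injective S ∧ pull F g s = c ∧
        ∀ (i : I) (f : G i ⟶ C), pull F f c = 0 → f ≫ g = 0) :
    ∃ (J : Type w) (_ : Preorder J) (σ : ElementSystem F J) (c : Cocone σ.diag)
      (t : F.obj (op c.pt)) (i₀ : J),
      (∀ j, pull F (c.ι.app j) t = σ.elt j) ∧
      (∀ (I : Type) [Countable I] (k : I → J), ∃ j, ∀ i, k i ≤ j) ∧
      (∀ j, ∃ k, j ≤ k ∧ Injective (σ.diag.obj k)) ∧
      (∀ (i : I) (x : F.obj (op (G i))),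
        ∃ f : G i ⟶ σ.diag.obj i₀, pull F f (σ.elt i₀) = x) ∧
      ∀ j : J, ∃ (k : J) (a : j ⟶ k), ∀ (i : I) (f : G i ⟶ σ.diag.obj j),
        pull F f (σ.elt j) = 0 → f ≫ σ.diag.map a = 0 := by
  have := preservesLimits_restrict (P := P) hF
  have : HasLimitsOfSize.{w, w} (restrict F P).Elements := ⟨fun _ _ => inferInstance⟩
  have hcol : HasColimitsOfSize.{w, w} (restrict F P).Elementsᵒᵖ := inferInstance
  choose S s g hS hSi hgs hkill using hstep
  let K : Type w := Σ i : I, F.obj (op (G i))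
  let Φ : SmallObject.SuccStruct (restrict F P).Elementsᵒᵖ :=
    -- The coproduct is taken among pairs, so it carries an element restricting to every prescribed
    -- one.
    { X₀ := ∐ fun k : K => elementsMk (G k.1) (hG k.1) k.2
      succ := fun e => elementsMk _ (hS _ e.unop.1.unop.property (elementsElt e)) (s _ _ _)
      toSucc := fun e => elementsHomMk (g _ e.unop.1.unop.property (elementsElt e)) (hgs _ _ _) }
  -- ℵ₁ is the least regular cardinal for which countable families of stages are bounded.
  let μ : Cardinal.{w} := Order.succ Cardinal.aleph0
  have hμ : μ.IsRegular := Cardinal.isRegular_succ le_rfl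
  have : Fact μ.IsRegular := ⟨hμ⟩
  have : NoMaxOrder μ.ord.ToType := Cardinal.noMaxOrder hμ.aleph0_le
  have : Nonempty μ.ord.ToType := IsCardinalFiltered.nonempty _ μ
  let : OrderBot μ.ord.ToType := WellFoundedLT.toOrderBot _
  let : SuccOrder μ.ord.ToType := SuccOrder.ofLinearWellFoundedLT _
  let Ψ := Φ.iterationFunctor μ.ord.ToType
  refine ⟨μ.ord.ToType, inferInstance,
    { diag := Ψ ⋙ elementsForget F P
      elt := fun j => elementsElt (Ψ.obj j)
      pull_elt := fun f => pull_elementsForget_map (Ψ.map f) },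
    (elementsForget F P).mapCocone (colimit.cocone Ψ), elementsElt (colimit Ψ), ⊥,
    fun j => pull_elementsForget_map (colimit.ι Ψ j), fun I _ k => ?_, fun j => ?_,
    fun i x => ?_, fun j => ?_⟩
  · have hI : HasCardinalLT I μ := by
      rw [hasCardinalLT_iff_of_equiv (Equiv.ulift.{w} (α := I)).symm,
        hasCardinalLT_iff_cardinal_mk_lt]
      exact Cardinal.mk_le_aleph0.trans_lt (Order.lt_succ _)
    exact ⟨IsCardinalFiltered.max k hI, fun i => leOfHom (IsCardinalFiltered.toMax k hI i)⟩
  -- Limit stages need not be injective, but successor stages are, and they are cofinal.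
  · refine ⟨Order.succ j, Order.le_succ j, ?_⟩
    exact Injective.of_iso ((elementsForget F P).mapIso
      (Φ.iterationFunctorObjSuccIso j (not_isMax j)).symm) (hSi _ _ _)
  · let a : elementsMk (P := P) (G i) (hG i) x ⟶ Ψ.obj ⊥ :=
      Sigma.ι (fun k : K => elementsMk (P := P) (G k.1) (hG k.1) k.2) ⟨i, x⟩ ≫
        (Φ.iterationFunctorObjBotIso _).inv
    exact ⟨(elementsForget F P).map a, pull_elementsForget_map a⟩
  · refine ⟨Order.succ j, homOfLE (Order.le_succ j), fun i f hf => ?_⟩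
    have h : (elementsForget F P).map (Ψ.map (homOfLE (Order.le_succ j))) =
      (g _ (Ψ.obj j).unop.1.unop.property (elementsElt (Ψ.obj j))) ≫
        (elementsForget F P).map (Φ.iterationFunctorObjSuccIso j (not_isMax j)).inv := by
      dsimp only [Ψ]
      rw [Φ.iterationFunctor_map_succ j (not_isMax j), Functor.map_comp]
      rfl
    refine (congrArg (f ≫ ·) h).trans ?_
    exact (Category.assoc _ _ _).symm.trans
      ((congrArg (· ≫ _) (hkill _ _ _ i f hf)).trans zero_comp)

end Iteration

end QuasiLocPres

/-! ### The representability theorem. -/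

open CategoryTheory CategoryTheory.Limits in
theorem theorem2p3 {A : Type u} [Category.{w} A] [Abelian A]
    (𝒜 : Cardinal.{w} → ObjectProperty A)
    (hA : QuasiLocPres.IsQuasiLocallyPresentable 𝒜)
    (κ : Cardinal.{w}) [Fact κ.IsRegular]
    (hinc : ∀ (μ ν : Cardinal.{w}) [Fact μ.IsRegular] [Fact ν.IsRegular], κ ≤ μ → μ ≤ ν →
      QuasiLocPres.presentablePart 𝒜 μ ≤ QuasiLocPres.presentablePart 𝒜 ν)
    (hgen : QuasiLocPres.IsWeaklyGenerated 𝒜 κ)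
    (hinj : ∀ (μ : Cardinal.{w}) [Fact μ.IsRegular], κ ≤ μ →
      ∀ X : A, QuasiLocPres.presentablePart 𝒜 μ X →
        ∃ (S : A) (f : X ⟶ S), QuasiLocPres.injectivePart 𝒜 μ S ∧ Mono f)
    (F : Aᵒᵖ ⥤ AddCommGrpCat.{w}) [PreservesFiniteLimits F] [PreservesFiniteColimits F]
    (hF : ∀ I : Type w, PreservesLimitsOfShape (Discrete I) F) :
    (∃ Z : A, Nonempty (F ≅ preadditiveYoneda.obj Z)) ∧
      ∀ Z : A, Nonempty (F ≅ preadditiveYoneda.obj Z) → Injective Z := by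
  open QuasiLocPres in
  refine ⟨?_, fun Z ⟨e⟩ => ?_⟩
  · have : F.Additive := Functor.additive_of_preserves_binary_products F
    obtain ⟨_, _⟩ := hasColimits_eventuallyPresentable (κ := κ) hA hinc
    have (J : Type w) [SmallCategory J] :=
      isClosedUnderColimits_eventuallyPresentable (κ := κ) hA hinc J
    obtain ⟨I, G, hG, hGκ⟩ := exists_small_generator (κ := κ) hA
    have hG' (i) : eventuallyPresentable 𝒜 κ (G i) := ⟨κ, inferInstance, le_rfl, hG i⟩
    have hinj' (X : A) : eventuallyPresentable 𝒜 κ X →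
        ∃ (S : A) (f : X ⟶ S), eventuallyPresentable 𝒜 κ S ∧ Injective S ∧ Mono f := by
      rintro ⟨μ, _, hμ, hX⟩
      obtain ⟨S, f, hS, hf⟩ := hinj μ hμ X hX
      exact ⟨S, f, ⟨μ, inferInstance, hμ, hS.2⟩, hS.1, hf⟩
    obtain ⟨J, _, σ, c, t, i₀, ht, hJ, hσ, h₀, hkill⟩ := exists_elementSystem hF hG'
      (exists_injective_annihilating hF _
        (fun J _ D hD => hasColimit_of_eventuallyPresentable hA hinc D hD) hinj' hG')
    have : IsDirectedOrder J := ⟨fun i j => by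
      obtain ⟨k, hk⟩ := hJ Bool (fun b => cond b i j)
      exact ⟨k, hk true, hk false⟩⟩
    refine σ.exists_iso_preadditiveYoneda (hgen σ.detects (fun X hX => ?_) ⟨?_⟩ ⟨?_⟩
      ⟨σ.detects_of_shortExact hσ⟩ fun I _ => ⟨?_⟩) c t ht
    · obtain ⟨K, _, p, hp⟩ := hGκ X hX
      have : HasCoproduct p.diag.obj := hasColimit_of_eventuallyPresentable hA hinc _ fun k => by
        obtain ⟨i, hi⟩ := hp k.as
        exact hi.symm ▸ hG' i
      exact σ.detects_of_colimitPresentation hF i₀ h₀ hkill p hp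
    · rintro _ ⟨f, k, hk, hf⟩
      exact σ.detects_of_isLimit_kernelFork hσ hk hf.1 hf.2
    · rintro _ ⟨f, k, hk, hf⟩
      exact σ.detects_of_isColimit_cokernelCofork hk hf.1 hf.2
    · rintro X ⟨p⟩
      exact σ.detects_of_isColimit_discrete hJ hF p.isColimit p.prop_diag_obj
  · rw [Injective.injective_iff_preservesEpimorphisms_preadditiveYoneda_obj]
    exact Functor.PreservesEpimorphisms.of_iso e
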